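/- Let $1 < d < \infty$, let $\mathbb{F}_d = \langle a_1, \ldots, a_d \rangle$ be the free group of rank $d$, and let $\partial \mathbb{F}_d$ be its Gromov boundary, that is, the space of infinite reduced words in the letters $a_i^{\pm 1}$ with the topology induced from the product of the discrete topologies, on which $\mathbb{F}_d$ acts by left multiplication followed by reduction. For $t \in \mathbb{F}_d \setminus \{e\}$ let $t^{\infty} \in \partial\mathbb{F}_d$ be the limit of $t^n$ as $n \to \infty$ in the Gromov compactification $\mathbb{F}_d \cup \partial \mathbb{F}_d$ (letterwise convergence of reduced words), and let $t^{-\infty} = (t^{-1})^{\infty}$. Let $\Gamma$ be a non-trivial normal subgroup of $\mathbb{F}_d$. Then the action of $\Gamma$ on $\partial \mathbb{F}_d$ is topologically free (for every $g \in \Gamma\setminus\{e\}$ the fixed point set of $g$ has empty interior) and minimal (every orbit is dense). Call an element of $\mathbb{F}_d$ indivisible if it is not of the form $h^n$ with $h \in \mathbb{F}_d$ and $n \ge 2$. Let $T \subset \mathbb{F}_d$ be a set of indivisible elements that meets only finitely many $\mathbb{F}_d$-conjugacy classes, and assume that $t^n \notin \Gamma$ for every $t \in T$ and every non-zero $n \in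 \mathbb{Z}$. Put $$\mathcal{R}_{T,\Gamma} = \{(x,x) \mid x \in \partial\mathbb{F}_d\} \cup \{(g.t^{\infty}, g.t^{-\infty}) \mid g \in \Gamma,\ t \in T \cup T^{-1}\}.$$ Then $\mathcal{R}_{T,\Gamma}$ is a $\Gamma$-invariant equivalence relation on $\partial \mathbb{F}_d$, and the quotient space $\partial \mathbb{F}_d/\mathcal{R}_{T,\Gamma}$ is Hausdorff. Moreover $\Gamma$ acts by homeomorphisms on $\partial \mathbb{F}_d/\mathcal{R}_{T,\Gamma}$ via $g.[x] = [g.x]$, and the quotient map $\pi \colon \partial\mathbb{F}_d \to \partial \mathbb{F}_d/\mathcal{R}_{T,\Gamma}$ is a $\Gamma$-equivariant topological quotient map which is proper (preimages of compact sets are compact) and satisfies $|\pi^{-1}(x)| = 1$ for every $x \in \partial \mathbb{F}_d/\mathcal{R}_{T,\Gamma}$ whose stabilizer in $\Gamma$ is non-trivial. -/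

import Mathlib

open Filter Topology

/-- The Gromov boundary of the free group on `d` generators: infinite reduced words in the
letters `(a, true)` (the generator `a`) and `(a, false)` (its inverse). As in Mathlib's
`FreeGroup.IsReduced`, a word is reduced if no letter is followed by its inverse. -/
def FreeBoundary (d : ℕ) : Type :=
  {x : ℕ → Fin d × Bool // ∀ n, (x n).1 = (x (n + 1)).1 → (x n).2 = (x (n + 1)).2}

namespace FreeBoundary

variable {d : ℕ}

/-- The topology induced from the product of the discrete topologies. -/
instance : TopologicalSpace (FreeBoundary d) :=
  inferInstanceAs (TopologicalSpace
    {x : ℕ → Fin d × Bool // ∀ n, (x n).1 = (x (n + 1)).1 → (x n).2 = (x (n + 1)).2})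

@[ext] theorem ext {x y : FreeBoundary d} (h : ∀ n, x.1 n = y.1 n) : x = y :=
  Subtype.ext (funext h)

/-- The reduced form of the infinite word `s x₀ x₁ x₂ …`, for a letter `s`. -/
def letterMul (s : Fin d × Bool) (x : FreeBoundary d) : FreeBoundary d :=
  if h : x.1 0 = (s.1, !s.2) then ⟨fun n => x.1 (n + 1), fun n => x.2 (n + 1)⟩
  else ⟨fun n => Nat.casesOn n s x.1, fun n => by
    cases n with
    | zero =>
      intro h1
      by_contra h2
      apply h
      refine Prod.ext h1.symm ?_
      change ¬ s.2 = (x.1 0).2 at h2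
      change (x.1 0).2 = !s.2
      cases h3 : s.2 <;> cases h4 : (x.1 0).2 <;> simp_all
    | succ n => exact x.2 n⟩

theorem letterMul_cancel (s : Fin d × Bool) (x : FreeBoundary d) :
    letterMul (s.1, !s.2) (letterMul s x) = x := by
  by_cases h : x.1 0 = (s.1, !s.2)
  · have h1 : ¬ (x.1 1) = s := by
      intro h1
      have := x.2 0
      simp [h, h1] at this
    apply ext
    intro n
    cases n <;> simp [letterMul, h, h1]
  · apply ext
    intro n
    simp [letterMul, h]

/-- The bijection of the boundary given by left multiplication by the generator `a`. -/
def genPerm (a : Fin d) : Equiv.Perm (FreeBoundary d) where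
  toFun := letterMul (a, true)
  invFun := letterMul (a, false)
  left_inv x := letterMul_cancel (a, true) x
  right_inv x := letterMul_cancel (a, false) x

/-- The action of the free group on its boundary: concatenation followed by reduction. -/
instance : MulAction (FreeGroup (Fin d)) (FreeBoundary d) :=
  MulAction.compHom (FreeBoundary d) (FreeGroup.lift (genPerm (d := d)))

theorem continuous_letterMul (s : Fin d × Bool) : Continuous (letterMul s) := by
  refine Continuous.subtype_mk (f := fun x : FreeBoundary d => (letterMul s x).1) ?_ _
  refine continuous_pi fun n => ?_
  have hc : ∀ m, Continuous fun x : FreeBoundary d => x.1 m := fun m =>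
    (continuous_apply m).comp continuous_subtype_val
  have : (fun x : FreeBoundary d => (letterMul s x).1 n) =
      (fun p : (Fin d × Bool) × (Fin d × Bool) × (Fin d × Bool) =>
        if p.1 = (s.1, !s.2) then p.2.1 else if n = 0 then s else p.2.2) ∘
      fun x : FreeBoundary d => (x.1 0, x.1 (n + 1), x.1 (n - 1)) := by
    funext x
    by_cases h : x.1 0 = (s.1, !s.2)
    · simp [letterMul, h]
    · cases n <;> simp [letterMul, h]
  rw [this]
  exact continuous_of_discreteTopology.comp ((hc _).prodMk ((hc _).prodMk (hc _)))

/-- The free group acts on its boundary by homeomorphisms. -/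
instance : ContinuousConstSMul (FreeGroup (Fin d)) (FreeBoundary d) where
  continuous_const_smul g := by
    induction g using FreeGroup.induction_on with
    | C1 =>
      simp only [one_smul]
      exact continuous_id
    | of a =>
      exact (continuous_letterMul (a, true)).congr fun x => by
        change _ = FreeGroup.lift (genPerm (d := d)) (FreeGroup.of a) x
        simp [genPerm]
    | inv_of a _ =>
      exact (continuous_letterMul (a, false)).congr fun x => by
        change _ = FreeGroup.lift (genPerm (d := d)) (FreeGroup.of a)⁻¹ x
        rw [map_inv, FreeGroup.lift_apply_of]
        rfl
    | mul g h hg hh =>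
      exact (hg.comp hh).congr fun x => (mul_smul g h x).symm

end FreeBoundary

/-- The Gromov compactification of the free group on `d` generators, as a set: the disjoint
union of the group and its boundary. -/
inductive FreeCompactification (d : ℕ) : Type
  | elt (g : FreeGroup (Fin d)) : FreeCompactification d
  | bdry (x : FreeBoundary d) : FreeCompactification d

namespace FreeCompactification

variable {d : ℕ}

/-- The `n`-th letter of a finite or infinite reduced word (`none` beyond its end). -/
def letter : FreeCompactification d → ℕ → Option (Fin d × Bool)
  | elt g, n => g.toWord[n]?
  | bdry x, n => some (x.1 n)

/-- The topology of the Gromov compactification: letterwise convergence, that is, the topology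
induced by `letter` from the product of the discrete topologies. -/
instance : TopologicalSpace (FreeCompactification d) :=
  TopologicalSpace.induced letter (@Pi.topologicalSpace ℕ _ fun _ => ⊥)

theorem tendsto_iff {f : ℕ → FreeCompactification d} {z : FreeCompactification d} :
    Tendsto f atTop (𝓝 z) ↔ ∀ k, ∀ᶠ n in atTop, letter (f n) k = letter z k := by
  let _ : TopologicalSpace (Option (Fin d × Bool)) := ⊥
  have _ : DiscreteTopology (Option (Fin d × Bool)) := ⟨rfl⟩
  rw [nhds_induced, tendsto_comap_iff, tendsto_pi_nhds]
  refine forall_congr' fun k => ?_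
  rw [nhds_discrete, tendsto_pure]
  rfl

end FreeCompactification

/-- `IsPowLimit t u` says that `u = t^∞`, i.e. that the powers `t ^ n` converge to the boundary
point `u` in the Gromov compactification. -/
def IsPowLimit {d : ℕ} (t : FreeGroup (Fin d)) (u : FreeBoundary d) : Prop :=
  Tendsto (fun n : ℕ => FreeCompactification.elt (t ^ n)) atTop
    (𝓝 (FreeCompactification.bdry u))

/-- The limit `t^∞` exists and is unique for every `t ≠ 1`. -/
theorem existsUnique_isPowLimit {d : ℕ} {t : FreeGroup (Fin d)} (ht : t ≠ 1) :
    ∃! u, IsPowLimit t u := by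
  obtain ⟨c, hc⟩ : ∃ c, c = FreeGroup.reduceCyclically.conjugator t.toWord := ⟨_, rfl⟩
  obtain ⟨w, hw⟩ : ∃ w, w = FreeGroup.reduceCyclically t.toWord := ⟨_, rfl⟩
  have hpow : ∀ n, (t ^ (n + 1)).toWord =
      c ++ (List.replicate (n + 1) w).flatten ++ FreeGroup.invRev c := by
    intro n
    rw [FreeGroup.toWord_pow, hc, hw]
    exact FreeGroup.reduceCyclically.reduce_flatten_replicate_succ
      FreeGroup.isReduced_toWord n
  have hw0 : w ≠ [] := by
    intro h
    apply ht
    rw [← FreeGroup.mk_toWord (x := t)]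
    have h1 := hpow 0
    simp only [zero_add, pow_one, h, List.replicate_one, List.flatten_cons, List.flatten_nil,
      List.append_nil] at h1
    rw [h1, ← FreeGroup.mul_mk, ← FreeGroup.inv_mk, mul_inv_cancel]
  obtain ⟨A, hA⟩ : ∃ A : ℕ → List (Fin d × Bool),
    A = fun n => c ++ (List.replicate n w).flatten := ⟨_, rfl⟩
  have hlen : ∀ n, n ≤ (A n).length := by
    intro n
    have : 1 ≤ w.length := List.length_pos_iff.2 hw0
    simp only [hA, List.length_append, List.length_flatten, List.map_replicate,
      List.sum_replicate, smul_eq_mul]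
    nlinarith
  have hpre : ∀ m n, m ≤ n → A m <+: A n := by
    intro m n h
    obtain ⟨k, rfl⟩ := Nat.exists_eq_add_of_le h
    refine ⟨(List.replicate k w).flatten, ?_⟩
    simp only [hA, List.replicate_add, List.flatten_append, List.append_assoc]
  have hget : ∀ m n k, m ≤ n → k < (A m).length → (A n)[k]? = (A m)[k]? := by
    intro m n k h hk
    obtain ⟨l, hl⟩ := hpre m n h
    rw [← hl, List.getElem?_append_left hk]
  have hred : ∀ n, FreeGroup.IsReduced (A (n + 1)) := by
    intro n
    refine FreeGroup.IsReduced.infix (FreeGroup.isReduced_toWord (x := t ^ (n + 1))) ?_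
    rw [hpow]
    exact ⟨[], FreeGroup.invRev c, by simp [hA]⟩
  have hk : ∀ k, k < (A (k + 1)).length := fun k => hlen (k + 1)
  obtain ⟨u, hu⟩ : ∃ u : ℕ → Fin d × Bool, ∀ k, (A (k + 1))[k]? = some (u k) :=
    ⟨fun k => (A (k + 1))[k]'(hk k), fun k => List.getElem?_eq_getElem (hk k)⟩
  have hu2 : ∀ k, (u k).1 = (u (k + 1)).1 → (u k).2 = (u (k + 1)).2 := by
    intro k
    have h1 := hu (k + 1)
    have h0 := hu k
    rw [← hget (k + 1) (k + 2) k (by omega) (hk k)] at h0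
    obtain ⟨h0', h0⟩ := List.getElem?_eq_some_iff.1 h0
    obtain ⟨h1', h1⟩ := List.getElem?_eq_some_iff.1 h1
    have := List.isChain_iff_getElem.1 (hred (k + 1)) k h1'
    rw [← h0, ← h1]
    exact this
  have hlim : ∀ k, ∀ n, k + 2 ≤ n → (t ^ n).toWord[k]? = some (u k) := by
    intro k n hn
    obtain ⟨m, rfl⟩ : ∃ m, n = m + 1 := ⟨n - 1, by omega⟩
    have h1 : c ++ (List.replicate (m + 1) w).flatten = A (m + 1) := by rw [hA]
    rw [hpow, h1, List.getElem?_append_left (lt_of_lt_of_le (by omega) (hlen (m + 1))),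
      hget (k + 1) (m + 1) k (by omega) (hk k), hu]
  refine ⟨⟨u, hu2⟩, FreeCompactification.tendsto_iff.2 fun k => ?_, fun v hv => ?_⟩
  · exact eventually_atTop.2 ⟨k + 2, hlim k⟩
  · apply FreeBoundary.ext
    intro k
    obtain ⟨n, hn1, hn2⟩ :=
      ((FreeCompactification.tendsto_iff.1 hv k).and (eventually_ge_atTop (k + 2))).exists
    have h1 : (t ^ n).toWord[k]? = some (v.1 k) := hn1
    rw [hlim k n hn2] at h1
    exact (Option.some.inj h1).symm

/-- An element of a group is indivisible if it is not a proper power. -/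
def Indivisible {G : Type*} [Group G] (g : G) : Prop :=
  ∀ (h : G) (n : ℕ), 2 ≤ n → h ^ n ≠ g

/-- An action is topologically free if the fixed point set of every non-neutral element has
empty interior. -/
def IsTopologicallyFree (G X : Type*) [Group G] [MulAction G X] [TopologicalSpace X] : Prop :=
  ∀ g : G, g ≠ 1 → interior (MulAction.fixedBy X g) = ∅

/-- The relation
`{(x, x)} ∪ {(g • t^∞, g • t^{-∞}) | g ∈ Γ, t ∈ T ∪ T⁻¹}` on the boundary. -/
def pairRel {d : ℕ} (T : Set (FreeGroup (Fin d))) (Γ : Subgroup (FreeGroup (Fin d))) :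
    Set (FreeBoundary d × FreeBoundary d) :=
  {p | p.1 = p.2} ∪
    {p | ∃ g ∈ Γ, ∃ t : FreeGroup (Fin d), (t ∈ T ∨ t⁻¹ ∈ T) ∧ ∃ u v : FreeBoundary d,
      IsPowLimit t u ∧ IsPowLimit t⁻¹ v ∧ p = (g • u, g • v)}

/-- A relation on `X` is `G`-invariant if `(x, y) ∈ R` implies `(g • x, g • y) ∈ R`. -/
def IsInvariantRel (G : Type*) {X : Type*} [Group G] [MulAction G X] (R : Set (X × X)) : Prop :=
  ∀ (g : G) (x y : X), (x, y) ∈ R → (g • x, g • y) ∈ R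

/-- The action induced on the quotient by an invariant equivalence relation,
`g • [x] = [g • x]`. -/
@[reducible] def quotientAction {G X : Type*} [Group G] [MulAction G X] (R : Set (X × X))
    (hE : Equivalence fun x y => (x, y) ∈ R) (hR : IsInvariantRel G R) :
    MulAction G (Quotient (Setoid.mk (fun x y => (x, y) ∈ R) hE)) where
  smul g := Quotient.map (g • ·) fun x y h => hR g x y h
  one_smul q := by
    induction q using Quotient.inductionOn with
    | _ x => exact congrArg (Quotient.mk _) (one_smul G x)
  mul_smul g h q := by
    induction q using Quotient.inductionOn with
    | _ x => exact congrArg (Quotient.mk _) (mul_smul g h x)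

/-! ### Prefixes of infinite words and stabilizers of boundary points -/

namespace FreeBoundary

variable {d : ℕ}

/-! Everything rests on two facts about the free group.

Stabilizers are cyclic: an element fixing a boundary point `x` shifts the long prefixes of `x` by a
constant, and this constant determines the element (`ShiftsPrefixes.eq`). Hence indivisible elements
with a common fixed point agree up to inversion (`eq_or_eq_inv_of_smul_eq`), so classes of `pairRel
T Γ` have at most two points, which gives transitivity. If a non-trivial `γ ∈ Γ` fixes a two-point
class, then `γ ^ 2` fixes a limit point of a conjugate of some `t ∈ T ∪ T⁻¹`; it is commensurable
with that conjugate, and normality puts a non-zero power of `t` into `Γ`, a contradiction.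

Only finitely many related pairs differ at a given letter: if the limit points of a conjugate `c w
c⁻¹` of `s` differ at letter `i`, with `w` cyclically reduced, then `|c| ≤ i` and `|w| ≤ |s|`
(`IsPowLimit.norm_conj_le`), and balls are finite. So the relation is closed, and a closed
equivalence relation on a compact Hausdorff space has a Hausdorff quotient.

Topological freeness and minimality follow by choosing letters that prevent cancellation, possible
since there are at least four letters. -/

theorem mk_singleton_smul (s : Fin d × Bool) (x : FreeBoundary d) :
    (FreeGroup.mk [s]) • x = letterMul s x := by
  obtain ⟨a, b⟩ := s
  cases b
  · have h : FreeGroup.mk [(a, false)] = (FreeGroup.of a)⁻¹ := rfl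
    change FreeGroup.lift (genPerm (d := d)) (FreeGroup.mk [(a, false)]) x = _
    rw [h, map_inv, FreeGroup.lift_apply_of]
    rfl
  · change FreeGroup.lift (genPerm (d := d)) (FreeGroup.of a) x = _
    rw [FreeGroup.lift_apply_of]
    rfl

/-- The group element spelled by the first `n` letters of an infinite word. -/
def prefixElt (x : ℕ → Fin d × Bool) (n : ℤ) : FreeGroup (Fin d) :=
  -- Integer lengths allow negative shifts; a negative length gives the empty prefix, which is
  -- irrelevant for large `n`.
  FreeGroup.mk ((List.range n.toNat).map x)

theorem prefixElt_add_one (x : ℕ → Fin d × Bool) {n : ℤ} (hn : 0 ≤ n) :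
    prefixElt x (n + 1) = FreeGroup.mk [x 0] * prefixElt (fun k => x (k + 1)) n := by
  lift n to ℕ using hn
  have : ((n : ℤ) + 1).toNat = n + 1 := by omega
  rw [prefixElt, prefixElt, this, List.range_succ_eq_map, FreeGroup.mul_mk]
  simp [Function.comp_def]

theorem isReduced_map_range (x : FreeBoundary d) (n : ℕ) :
    FreeGroup.IsReduced ((List.range n).map x.1) := by
  rw [FreeGroup.IsReduced, List.isChain_iff_getElem]
  intro i hi
  simpa using x.2 i

/-- Left multiplication by `g` maps the long prefixes of `x` to prefixes of `y`, with the lengths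
increased by `c`. -/
def ShiftsPrefixes (g : FreeGroup (Fin d)) (x y : FreeBoundary d) (c : ℤ) : Prop :=
  ∀ᶠ n : ℤ in atTop, g * prefixElt x.1 n = prefixElt y.1 (n + c)

theorem ShiftsPrefixes.mul {g h : FreeGroup (Fin d)} {x y z : FreeBoundary d} {b c : ℤ}
    (hg : ShiftsPrefixes g y z b) (hh : ShiftsPrefixes h x y c) :
    ShiftsPrefixes (g * h) x z (b + c) := by
  have := (tendsto_atTop_add_const_right atTop c tendsto_id).eventually hg
  filter_upwards [this, hh] with n h1 h2
  rw [mul_assoc, h2]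
  simp only [id] at h1
  rw [h1, add_assoc, add_comm c b]

theorem ShiftsPrefixes.one (x : FreeBoundary d) : ShiftsPrefixes 1 x x 0 :=
  Eventually.of_forall fun n => by simp

theorem ShiftsPrefixes.inv {g : FreeGroup (Fin d)} {x y : FreeBoundary d} {c : ℤ}
    (hg : ShiftsPrefixes g x y c) : ShiftsPrefixes g⁻¹ y x (-c) := by
  have := (tendsto_atTop_add_const_right atTop (-c) tendsto_id).eventually hg
  filter_upwards [this] with n h1
  simp only [id, neg_add_cancel_right] at h1
  rw [← h1, inv_mul_cancel_left]

theorem ShiftsPrefixes.pow {g : FreeGroup (Fin d)} {x : FreeBoundary d} {c : ℤ}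
    (hg : ShiftsPrefixes g x x c) (n : ℕ) : ShiftsPrefixes (g ^ n) x x (n * c) := by
  induction n with
  | zero => simpa using ShiftsPrefixes.one x
  | succ n ih =>
    rw [pow_succ]
    convert ih.mul hg using 1
    push_cast
    ring

theorem ShiftsPrefixes.zpow {g : FreeGroup (Fin d)} {x : FreeBoundary d} {c : ℤ}
    (hg : ShiftsPrefixes g x x c) (n : ℤ) : ShiftsPrefixes (g ^ n) x x (n * c) := by
  obtain ⟨n, rfl | rfl⟩ := n.eq_nat_or_neg
  · simpa using hg.pow n
  · simpa using (hg.pow n).inv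

/-- A single common long prefix can be cancelled. For `x = y` this makes the shift an injective
invariant on the stabilizer of `x`. -/
theorem ShiftsPrefixes.eq {g h : FreeGroup (Fin d)} {x y : FreeBoundary d} {c : ℤ}
    (hg : ShiftsPrefixes g x y c) (hh : ShiftsPrefixes h x y c) : g = h := by
  obtain ⟨n, h1, h2⟩ := (hg.and hh).exists
  exact mul_right_cancel (h1.trans h2.symm)

theorem exists_shiftsPrefixes_letterMul (s : Fin d × Bool) (x : FreeBoundary d) :
    ∃ c, ShiftsPrefixes (FreeGroup.mk [s]) x (letterMul s x) c := by
  by_cases h : x.1 0 = (s.1, !s.2)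
  · refine ⟨-1, ?_⟩
    filter_upwards [eventually_ge_atTop 1] with n hn
    obtain ⟨m, rfl⟩ : ∃ m, n = m + 1 := ⟨n - 1, by ring⟩
    have h1 : FreeGroup.mk [x.1 0] = (FreeGroup.mk [s])⁻¹ := by
      rw [h, FreeGroup.inv_mk]
      rfl
    rw [prefixElt_add_one _ (by omega), h1, mul_inv_cancel_left, add_neg_cancel_right]
    simp [letterMul, h]
  · refine ⟨1, ?_⟩
    filter_upwards [eventually_ge_atTop 0] with n hn
    rw [prefixElt_add_one _ hn]
    simp [letterMul, h]

theorem exists_shiftsPrefixes (g : FreeGroup (Fin d)) (x : FreeBoundary d) :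
    ∃ c, ShiftsPrefixes g x (g • x) c := by
  induction g using FreeGroup.induction_on generalizing x with
  | C1 => exact ⟨0, by simpa using ShiftsPrefixes.one x⟩
  | of a =>
    obtain ⟨c, hc⟩ := exists_shiftsPrefixes_letterMul (a, true) x
    exact ⟨c, by rw [← mk_singleton_smul] at hc; exact hc⟩
  | inv_of a _ =>
    obtain ⟨c, hc⟩ := exists_shiftsPrefixes_letterMul (a, false) x
    exact ⟨c, by rw [← mk_singleton_smul] at hc; exact hc⟩
  | mul g h hg hh =>
    obtain ⟨c, hc⟩ := hh x
    obtain ⟨b, hb⟩ := hg (h • x)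
    exact ⟨b + c, by rw [mul_smul]; exact hb.mul hc⟩

/-- An element of the stabilizer of a boundary point is determined by its translation length. -/
theorem exists_shiftsPrefixes_of_smul_eq {g : FreeGroup (Fin d)} {x : FreeBoundary d}
    (hg : g • x = x) (hg1 : g ≠ 1) : ∃ c ≠ 0, ShiftsPrefixes g x x c := by
  obtain ⟨c, hc⟩ := exists_shiftsPrefixes g x
  rw [hg] at hc
  refine ⟨c, ?_, hc⟩
  rintro rfl
  exact hg1 (hc.eq (ShiftsPrefixes.one x))

/-- Two non-neutral elements with a common fixed point on the boundary are commensurable. -/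
theorem exists_zpow_eq_zpow_of_smul_eq {g h : FreeGroup (Fin d)} {x : FreeBoundary d}
    (hg : g • x = x) (hh : h • x = x) (hg1 : g ≠ 1) (hh1 : h ≠ 1) :
    ∃ m n : ℤ, m ≠ 0 ∧ n ≠ 0 ∧ g ^ m = h ^ n := by
  obtain ⟨b, hb0, hb⟩ := exists_shiftsPrefixes_of_smul_eq hg hg1
  obtain ⟨c, hc0, hc⟩ := exists_shiftsPrefixes_of_smul_eq hh hh1
  -- Both `g ^ c` and `h ^ b` shift by `b * c`.
  refine ⟨c, b, hc0, hb0, (hb.zpow c).eq ?_⟩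
  rw [mul_comm]
  exact hc.zpow b

theorem _root_.Indivisible.ne_one {G : Type*} [Group G] {g : G} (hg : Indivisible g) : g ≠ 1 :=
  fun h => hg 1 2 le_rfl (by rw [h, one_pow])

theorem _root_.Indivisible.inv {G : Type*} [Group G] {g : G} (hg : Indivisible g) :
    Indivisible g⁻¹ := fun h n hn he => hg h⁻¹ n hn (by rw [inv_pow, he, inv_inv])

theorem _root_.Indivisible.conj {G : Type*} [Group G] {g : G} (hg : Indivisible g) (k : G) :
    Indivisible (k * g * k⁻¹) := fun h n hn he => hg (k⁻¹ * h * k) n hn (by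
  have := conj_pow (i := n) (a := k⁻¹) (b := h)
  rw [inv_inv] at this
  rw [this, he]
  group)

theorem _root_.Indivisible.eq_one_or_eq_neg_one {G : Type*} [Group G] {g h : G}
    (hg : Indivisible g) {n : ℤ} (h1 : h ^ n = g) : n = 1 ∨ n = -1 := by
  obtain ⟨n, rfl | rfl⟩ := n.eq_nat_or_neg
  · have h2 : ¬ 2 ≤ n := fun hn => hg h n hn (by simpa using h1)
    have h3 : n ≠ 0 := by
      rintro rfl
      exact hg.ne_one (by simpa using h1.symm)
    omega
  · have h2 : ¬ 2 ≤ n := fun hn => hg h⁻¹ n hn (by simpa using h1)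
    have h3 : n ≠ 0 := by
      rintro rfl
      exact hg.ne_one (by simpa using h1.symm)
    omega

/-- Indivisible elements with a common fixed point on the boundary agree up to inversion. -/
theorem eq_or_eq_inv_of_smul_eq {g h : FreeGroup (Fin d)} {x : FreeBoundary d}
    (hg : g • x = x) (hh : h • x = x) (hg1 : Indivisible g) (hh1 : Indivisible h) :
    h = g ∨ h = g⁻¹ := by
  obtain ⟨b, hb0, hb⟩ := exists_shiftsPrefixes_of_smul_eq hg hg1.ne_one
  obtain ⟨c, hc0, hc⟩ := exists_shiftsPrefixes_of_smul_eq hh hh1.ne_one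
  -- By Bézout this product shifts by the gcd, so `g` and `h` are both powers of it; indivisibility
  -- forces the exponents to be `±1`.
  have hw : ShiftsPrefixes (g ^ b.gcdA c * h ^ b.gcdB c) x x (Int.gcd b c) := by
    convert (hb.zpow (b.gcdA c)).mul (hc.zpow (b.gcdB c)) using 1
    rw [Int.gcd_eq_gcd_ab]
    ring
  obtain ⟨m, hm⟩ := Int.gcd_dvd_left b c
  obtain ⟨n, hn⟩ := Int.gcd_dvd_right b c
  have h1 : (g ^ b.gcdA c * h ^ b.gcdB c) ^ m = g :=
    (hw.zpow m).eq (by rwa [mul_comm, ← hm])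
  have h2 : (g ^ b.gcdA c * h ^ b.gcdB c) ^ n = h :=
    (hw.zpow n).eq (by rwa [mul_comm, ← hn])
  generalize g ^ b.gcdA c * h ^ b.gcdB c = w at *
  obtain rfl | rfl := hg1.eq_one_or_eq_neg_one h1 <;>
    obtain rfl | rfl := hh1.eq_one_or_eq_neg_one h2 <;> rw [← h1, ← h2] <;> simp

end FreeBoundary

/-! ### Multiplication on the Gromov compactification -/

namespace FreeCompactification

variable {d : ℕ}

theorem tendsto_unique {f : ℕ → FreeCompactification d} {x y : FreeBoundary d}
    (hx : Tendsto f atTop (𝓝 (bdry x))) (hy : Tendsto f atTop (𝓝 (bdry y))) : x = y := by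
  apply FreeBoundary.ext
  intro k
  obtain ⟨n, h1, h2⟩ := ((tendsto_iff.1 hx k).and (tendsto_iff.1 hy k)).exists
  exact Option.some.inj (h1.symm.trans h2)

/-- The `k`-th letter of the reduced form of `s w`, in terms of the zeroth, the `(k + 1)`-st and
the `(k - 1)`-st letter of the reduced word `w`. -/
def consLetter (s : Fin d × Bool) (k : ℕ) (a b c : Option (Fin d × Bool)) :
    Option (Fin d × Bool) :=
  if a = some (s.1, !s.2) then b else if k = 0 then some s else c

/-- Only three letters of `L` matter, and `letter_letterMul` gives the same formula for infinite
words; this is why left multiplication preserves letterwise convergence. The truncated `k - 1` is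
not read when `k = 0`. -/
theorem getElem?_reduce_cons (s : Fin d × Bool) {L : List (Fin d × Bool)}
    (hL : FreeGroup.IsReduced L) (k : ℕ) :
    (FreeGroup.reduce (s :: L))[k]? = consLetter s k L[0]? L[k + 1]? L[k - 1]? := by
  obtain ⟨a, b⟩ := s
  rw [FreeGroup.reduce.cons, hL.reduce_eq, consLetter]
  rcases L with _ | ⟨⟨a', b'⟩, l⟩
  · cases k <;> simp
  · have h3 : (a = a' ∧ b = !b') ↔ (a' = a ∧ b' = !b) := by
      cases b <;> cases b' <;> simp [eq_comm]
    by_cases h4 : a' = a ∧ b' = !b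
    · simp [h4]
    · cases k <;> simp [h3, h4]

theorem letter_mk_singleton_mul (s : Fin d × Bool) (h : FreeGroup (Fin d)) (k : ℕ) :
    letter (elt (FreeGroup.mk [s] * h)) k =
      consLetter s k (letter (elt h) 0) (letter (elt h) (k + 1)) (letter (elt h) (k - 1)) := by
  have h1 : (FreeGroup.mk [s] * h).toWord = FreeGroup.reduce (s :: h.toWord) := by
    rw [FreeGroup.toWord_mul, FreeGroup.toWord_mk, FreeGroup.reduce_singleton]
    rfl
  simp only [letter, h1, consLetter]
  exact getElem?_reduce_cons s FreeGroup.isReduced_toWord k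

theorem letter_letterMul (s : Fin d × Bool) (x : FreeBoundary d) (k : ℕ) :
    letter (bdry (FreeBoundary.letterMul s x)) k =
      consLetter s k (letter (bdry x) 0) (letter (bdry x) (k + 1)) (letter (bdry x) (k - 1)) := by
  by_cases h : x.1 0 = (s.1, !s.2)
  · simp [letter, consLetter, FreeBoundary.letterMul, h]
  · cases k <;> simp [letter, consLetter, FreeBoundary.letterMul, h]

theorem tendsto_mk_singleton_mul (s : Fin d × Bool) {f : ℕ → FreeGroup (Fin d)}
    {x : FreeBoundary d} (hf : Tendsto (fun n => elt (f n)) atTop (𝓝 (bdry x))) :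
    Tendsto (fun n => elt (FreeGroup.mk [s] * f n)) atTop
      (𝓝 (bdry (FreeGroup.mk [s] • x))) := by
  rw [tendsto_iff] at *
  intro k
  filter_upwards [hf 0, hf (k + 1), hf (k - 1)] with n h1 h2 h3
  rw [letter_mk_singleton_mul, FreeBoundary.mk_singleton_smul, letter_letterMul, h1, h2, h3]

/-- Left multiplication on the compactification is continuous at boundary points. -/
theorem tendsto_mul_left (g : FreeGroup (Fin d)) {f : ℕ → FreeGroup (Fin d)}
    {x : FreeBoundary d} (hf : Tendsto (fun n => elt (f n)) atTop (𝓝 (bdry x))) :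
    Tendsto (fun n => elt (g * f n)) atTop (𝓝 (bdry (g • x))) := by
  induction g using FreeGroup.induction_on generalizing f x with
  | C1 => simpa using hf
  | of a => exact tendsto_mk_singleton_mul (a, true) hf
  | inv_of a _ => exact tendsto_mk_singleton_mul (a, false) hf
  | mul g h hg hh =>
    simp only [mul_assoc, mul_smul]
    exact hg (hh hf)

/-- Right multiplication by a letter only appends a letter or deletes the last one, and position `k`
is not the last. -/
theorem letter_mul_mk_singleton (s : Fin d × Bool) (h : FreeGroup (Fin d)) {k : ℕ}
    (hk : letter (elt h) (k + 1) ≠ none) :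
    letter (elt (h * FreeGroup.mk [s])) k = letter (elt h) k := by
  have hred : FreeGroup.IsReduced h.toWord := FreeGroup.isReduced_toWord
  simp only [letter, ne_eq, List.getElem?_eq_none_iff, not_le] at hk ⊢
  rw [FreeGroup.toWord_mul, FreeGroup.toWord_mk, FreeGroup.reduce_singleton]
  obtain ⟨L, l, hL⟩ : ∃ L l, h.toWord = L ++ [l] :=
    ⟨_, _, (List.dropLast_append_getLast (List.ne_nil_of_length_pos (by omega))).symm⟩
  rw [hL] at hk hred ⊢
  simp only [List.length_append, List.length_cons, List.length_nil] at hk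
  by_cases h1 : l.1 = s.1 → l.2 = s.2
  · have h2 : FreeGroup.IsReduced (L ++ [l] ++ [s]) :=
      hred.append_overlap (L₃ := [s])
        (FreeGroup.isReduced_cons_cons.2 ⟨h1, FreeGroup.IsReduced.singleton⟩) (by simp)
    rw [h2.reduce_eq, List.getElem?_append_left (by simp; omega)]
  · obtain ⟨a, b⟩ := l
    obtain ⟨a', b'⟩ := s
    simp only [Classical.not_imp] at h1
    obtain ⟨rfl, h1⟩ := h1
    have h3 : b' = !b := by cases b <;> cases b' <;> simp_all
    have h2 : FreeGroup.reduce (L ++ [(a, b)] ++ [(a, b')]) = FreeGroup.reduce L := by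
      refine FreeGroup.reduce.Step.eq ?_
      rw [h3]
      simpa using FreeGroup.Red.Step.not (L₁ := L) (L₂ := []) (x := a) (b := b)
    rw [h2, (hred.infix ⟨[], [(a, b)], by simp⟩ : FreeGroup.IsReduced L).reduce_eq,
      List.getElem?_append_left (by omega)]

theorem tendsto_mul_mk_singleton (s : Fin d × Bool) {f : ℕ → FreeGroup (Fin d)}
    {x : FreeBoundary d} (hf : Tendsto (fun n => elt (f n)) atTop (𝓝 (bdry x))) :
    Tendsto (fun n => elt (f n * FreeGroup.mk [s])) atTop (𝓝 (bdry x)) := by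
  rw [tendsto_iff] at *
  intro k
  filter_upwards [hf k, hf (k + 1)] with n h1 h2
  rw [letter_mul_mk_singleton s _ (by rw [h2]; simp [letter]), h1]

/-- Right multiplication extends to the boundary as the identity. -/
theorem tendsto_mul_right (g : FreeGroup (Fin d)) {f : ℕ → FreeGroup (Fin d)}
    {x : FreeBoundary d} (hf : Tendsto (fun n => elt (f n)) atTop (𝓝 (bdry x))) :
    Tendsto (fun n => elt (f n * g)) atTop (𝓝 (bdry x)) := by
  induction g using FreeGroup.induction_on generalizing f with
  | C1 => simpa using hf
  | of a => exact tendsto_mul_mk_singleton (a, true) hf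
  | inv_of a _ => exact tendsto_mul_mk_singleton (a, false) hf
  | mul g h hg hh =>
    simp only [← mul_assoc]
    exact hh (hg hf)

end FreeCompactification

/-! ### Limits of powers -/

namespace IsPowLimit

variable {d : ℕ} {t : FreeGroup (Fin d)} {u v : FreeBoundary d}

theorem unique (hu : IsPowLimit t u) (hv : IsPowLimit t v) : u = v :=
  FreeCompactification.tendsto_unique hu hv

theorem conj (hu : IsPowLimit t u) (g : FreeGroup (Fin d)) :
    IsPowLimit (g * t * g⁻¹) (g • u) := by
  unfold IsPowLimit
  simp only [conj_pow]
  exact FreeCompactification.tendsto_mul_right _ (FreeCompactification.tendsto_mul_left g hu)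

theorem smul_eq (hu : IsPowLimit t u) : t • u = u := by
  refine FreeCompactification.tendsto_unique (FreeCompactification.tendsto_mul_left t hu) ?_
  simp only [← pow_succ']
  exact (tendsto_add_atTop_iff_nat 1).2 hu

/-- The length of a conjugate is controlled by the number of letters which its attracting and its
repelling point have in common. -/
theorem norm_conj_le {g s : FreeGroup (Fin d)} (hu : IsPowLimit (g * s * g⁻¹) u)
    (hv : IsPowLimit (g * s * g⁻¹)⁻¹ v) {i : ℕ} (hi : u.1 i ≠ v.1 i) :
    (g * s * g⁻¹).norm ≤ 2 * i + s.norm := by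
  obtain ⟨a, ha⟩ : ∃ a, a = g * s * g⁻¹ := ⟨_, rfl⟩
  obtain ⟨c, hc⟩ : ∃ c, c = FreeGroup.reduceCyclically.conjugator a.toWord := ⟨_, rfl⟩
  obtain ⟨w, hw⟩ : ∃ w, w = FreeGroup.reduceCyclically a.toWord := ⟨_, rfl⟩
  have hpow : ∀ n, (a ^ (n + 1)).toWord =
      c ++ (List.replicate (n + 1) w).flatten ++ FreeGroup.invRev c := by
    intro n
    rw [FreeGroup.toWord_pow, hc, hw]
    exact FreeGroup.reduceCyclically.reduce_flatten_replicate_succ FreeGroup.isReduced_toWord n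
  have hnorm : ∀ n, (a ^ (n + 1)).norm = 2 * c.length + (n + 1) * w.length := by
    intro n
    simp only [FreeGroup.norm, hpow, List.length_append, List.length_flatten, List.map_replicate,
      List.sum_replicate, smul_eq_mul, FreeGroup.invRev_length]
    ring
  have hs : ∀ n, (s ^ n).norm ≤ n * s.norm := by
    intro n
    induction n with
    | zero => simp
    | succ n ih =>
      rw [pow_succ, add_mul, one_mul]
      exact (FreeGroup.norm_mul_le _ _).trans (by omega)
  -- Compare growth: `|a ^ n|` is `2|c| + n|w|` but at most `n|s| + 2|g|`. If `|w| > |s|`, this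
  -- already fails at `n = 2|g| + 1`.
  have hwlen : w.length ≤ s.norm := by
    by_contra! h
    have h1 := hnorm (2 * g.norm)
    have h2 : (a ^ (2 * g.norm + 1)).norm ≤ (2 * g.norm + 1) * s.norm + 2 * g.norm := by
      rw [ha, conj_pow]
      have h3 := FreeGroup.norm_mul_le (g * s ^ (2 * g.norm + 1)) g⁻¹
      have h4 := FreeGroup.norm_mul_le g (s ^ (2 * g.norm + 1))
      have h5 := hs (2 * g.norm + 1)
      rw [FreeGroup.norm_inv_eq] at h3
      omega
    nlinarith
  -- All positive and negative powers of `a` begin with `c`, so `u` and `v` agree on the first `|c|`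
  -- letters.
  have hclen : c.length ≤ i := by
    by_contra! h
    apply hi
    obtain ⟨n, h1, h2⟩ := ((FreeCompactification.tendsto_iff.1
      ((tendsto_add_atTop_iff_nat 1).2 hu) i).and (FreeCompactification.tendsto_iff.1
      ((tendsto_add_atTop_iff_nat 1).2 hv) i)).exists
    rw [← ha] at h1 h2
    simp only [FreeCompactification.letter, inv_pow, FreeGroup.toWord_inv, hpow,
      FreeGroup.invRev_append, FreeGroup.invRev_invRev, List.append_assoc,
      List.getElem?_append_left h] at h1 h2
    exact Option.some.inj (h1.symm.trans h2)
  rw [← ha]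
  have h1 := hnorm 0
  simp only [zero_add, pow_one, one_mul] at h1
  omega

end IsPowLimit

/-! ### Topology of the boundary, topological freeness and minimality -/

namespace FreeBoundary

variable {d : ℕ}

theorem isClosed_setOf_reduced : IsClosed
    {x : ℕ → Fin d × Bool | ∀ n, (x n).1 = (x (n + 1)).1 → (x n).2 = (x (n + 1)).2} := by
  simp only [Set.ofPred_forall]
  refine isClosed_iInter fun n => ?_
  have hc : Continuous fun x : ℕ → Fin d × Bool => (x n, x (n + 1)) :=
    (continuous_apply n).prodMk (continuous_apply (n + 1))
  exact (isClosed_discrete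
    {p : (Fin d × Bool) × (Fin d × Bool) | p.1.1 = p.2.1 → p.1.2 = p.2.2}).preimage hc

instance : CompactSpace (FreeBoundary d) :=
  isCompact_iff_compactSpace.1 isClosed_setOf_reduced.isCompact

instance : T2Space (FreeBoundary d) :=
  inferInstanceAs (T2Space
    {x : ℕ → Fin d × Bool // ∀ n, (x n).1 = (x (n + 1)).1 → (x n).2 = (x (n + 1)).2})

theorem isOpen_setOf_apply (n : ℕ) (s : Set (Fin d × Bool)) :
    IsOpen {x : FreeBoundary d | x.1 n ∈ s} :=
  (isOpen_discrete s).preimage ((continuous_apply n).comp continuous_subtype_val)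

/-- The cylinder sets form a neighbourhood basis. -/
theorem exists_forall_lt_imp_mem {U : Set (FreeBoundary d)} (hU : IsOpen U) {x : FreeBoundary d}
    (hx : x ∈ U) : ∃ n, ∀ y : FreeBoundary d, (∀ i < n, y.1 i = x.1 i) → y ∈ U := by
  obtain ⟨V, hV, rfl⟩ := isOpen_induced_iff.1 hU
  obtain ⟨I, u, hI, hIV⟩ := isOpen_pi_iff.1 hV x.1 hx
  refine ⟨I.sup id + 1, fun y hy => hIV fun i hi => ?_⟩
  rw [hy i (Nat.lt_succ_of_le (Finset.le_sup (f := id) hi))]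
  exact (hI i hi).2

/-- Letters of `g • x` if there is no cancellation between `g = L` and `x`. -/
theorem mk_smul_apply {L : List (Fin d × Bool)} {x : FreeBoundary d}
    (h : FreeGroup.IsReduced (L ++ [x.1 0])) {n : ℕ} (hn : n ≤ L.length) :
    some ((FreeGroup.mk L • x).1 n) = (L ++ [x.1 0])[n]? := by
  induction L generalizing n with
  | nil =>
    obtain rfl : n = 0 := by simpa using hn
    have : FreeGroup.mk ([] : List (Fin d × Bool)) = 1 := rfl
    simp [this]
  | cons s L ih =>
    have h1 : FreeGroup.IsReduced (L ++ [x.1 0]) := h.infix ⟨[s], [], by simp⟩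
    have h2 : FreeGroup.mk (s :: L) • x = letterMul s (FreeGroup.mk L • x) := by
      rw [← mk_singleton_smul, ← mul_smul, FreeGroup.mul_mk]
      rfl
    have h3 : (FreeGroup.mk L • x).1 0 ≠ (s.1, !s.2) := by
      intro h3
      have h4 := ih h1 (Nat.zero_le _)
      rw [h3] at h4
      cases hL : L ++ [x.1 0] with
      | nil => simp at hL
      | cons a l =>
        rw [List.cons_append, hL] at h
        rw [hL] at h4
        simp only [List.getElem?_cons_zero, Option.some.injEq] at h4
        have := (FreeGroup.isReduced_cons_cons.1 h).1
        rw [← h4] at this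
        simp at this
    rw [h2]
    cases n with
    | zero => simp [letterMul, h3]
    | succ n =>
      have := ih h1 (n := n) (by simpa using hn)
      simp [letterMul, h3, this]

/-- The infinite word in which one letter is repeated. -/
def const (s : Fin d × Bool) : FreeBoundary d := ⟨fun _ => s, fun _ _ => rfl⟩

theorem exists_letter_ne (hd : 2 ≤ d) (a b c : Fin d × Bool) : ∃ e, e ≠ a ∧ e ≠ b ∧ e ≠ c := by
  have h : ({a, b, c} : Finset (Fin d × Bool)).card < Fintype.card (Fin d × Bool) := by
    refine Finset.card_le_three.trans_lt ?_
    simp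
    omega
  obtain ⟨e, he⟩ := Finset.exists_mem_notMem_of_card_lt_card (s := {a, b, c}) (t := Finset.univ) h
  exact ⟨e, by simpa using he.2⟩

theorem isReduced_append {L M : List (Fin d × Bool)} (hL : FreeGroup.IsReduced L)
    (hM : FreeGroup.IsReduced M)
    (h : ∀ s ∈ L.getLast?, ∀ e ∈ M.head?, e ≠ (s.1, !s.2)) : FreeGroup.IsReduced (L ++ M) := by
  refine List.isChain_append.2 ⟨hL, hM, ?_⟩
  rintro ⟨a, b⟩ hx ⟨a', b'⟩ hy hab
  have := h _ hx _ hy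
  change a = a' at hab
  change b = b'
  cases b <;> cases b' <;> simp_all

theorem isReduced_invRev {L : List (Fin d × Bool)} (hL : FreeGroup.IsReduced L) :
    FreeGroup.IsReduced (FreeGroup.invRev L) := by
  rw [FreeGroup.isReduced_iff_reduce_eq, FreeGroup.reduce_invRev, hL.reduce_eq]

theorem isTopologicallyFree (hd : 2 ≤ d) (Γ : Subgroup (FreeGroup (Fin d))) :
    IsTopologicallyFree Γ (FreeBoundary d) := by
  intro g hg
  by_contra hne
  obtain ⟨x, hx⟩ := Set.nonempty_iff_ne_empty.2 hne
  obtain ⟨n, hn⟩ := exists_forall_lt_imp_mem isOpen_interior hx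
  obtain ⟨p, hp⟩ : ∃ p, p = (List.range (n + 1)).map x.1 := ⟨_, rfl⟩
  have hpl : p.length = n + 1 := by simp [hp]
  have hpr : FreeGroup.IsReduced p := hp ▸ isReduced_map_range x _
  -- If `g` fixes the cylinder of `p` pointwise, this conjugate fixes every word that can follow `p`
  -- without cancellation.
  obtain ⟨h, hh⟩ : ∃ h, h = (FreeGroup.mk p)⁻¹ * (g : FreeGroup (Fin d)) * FreeGroup.mk p :=
    ⟨_, rfl⟩
  have hfix : ∀ z : FreeBoundary d, z.1 0 ≠ ((x.1 n).1, !(x.1 n).2) → h • z = z := by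
    intro z hz
    have hred : FreeGroup.IsReduced (p ++ [z.1 0]) :=
      isReduced_append hpr FreeGroup.IsReduced.singleton (by
        simp only [hp, List.range_succ]
        simpa using hz)
    have hmem : FreeGroup.mk p • z ∈ interior (MulAction.fixedBy (FreeBoundary d) g) := by
      refine hn _ fun i hi => ?_
      have := mk_smul_apply hred (n := i) (by omega)
      rw [List.getElem?_append_left (by omega)] at this
      apply Option.some.inj
      rw [this]
      simp [hp, show i < n + 1 by omega]
    have := interior_subset hmem
    rw [MulAction.mem_fixedBy, Subgroup.smul_def] at this
    rw [hh, mul_smul, mul_smul, this, inv_smul_smul]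
  have hh1 : h ≠ 1 := by
    rintro rfl
    apply hg
    have h1 : (g : FreeGroup (Fin d)) = FreeGroup.mk p *
      ((FreeGroup.mk p)⁻¹ * (g : FreeGroup (Fin d)) * FreeGroup.mk p) * (FreeGroup.mk p)⁻¹ := by
      group
    rw [← hh, mul_one, mul_inv_cancel] at h1
    exact Subtype.ext h1
  have hw : h.toWord ≠ [] := fun h1 => hh1 (FreeGroup.toWord_eq_nil_iff.1 h1)
  -- The three exclusions: `h` fixes the word `e e e …`; there is no cancellation between `h` and
  -- this word; and `h` does not begin with `e`. They contradict each other.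
  obtain ⟨e, he1, he2, he3⟩ := exists_letter_ne hd ((x.1 n).1, !(x.1 n).2)
    ((h.toWord.getLast hw).1, !(h.toWord.getLast hw).2) (h.toWord.head hw)
  have hred : FreeGroup.IsReduced (h.toWord ++ [(const e).1 0]) :=
    isReduced_append FreeGroup.isReduced_toWord FreeGroup.IsReduced.singleton (by
      simpa [List.getLast?_eq_some_getLast hw, const] using he2)
  have h1 := mk_smul_apply hred (Nat.zero_le _)
  rw [FreeGroup.mk_toWord, hfix (const e) he1, List.getElem?_append_left
    (List.length_pos_iff.2 hw), ← List.head?_eq_getElem?, List.head?_eq_some_head hw] at h1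
  exact he3 (Option.some.inj h1)

/-- A non-trivial normal subgroup contains, for each cylinder, an element which maps all words
starting with another letter than the cylinder to that cylinder. -/
theorem exists_mem_forall_smul_apply (hd : 2 ≤ d) {Γ : Subgroup (FreeGroup (Fin d))}
    (hΓ : Γ.Normal) (hΓ1 : Γ ≠ ⊥) {p : List (Fin d × Bool)} (hp : FreeGroup.IsReduced p)
    (hp0 : p ≠ []) :
    ∃ g ∈ Γ, ∀ x : FreeBoundary d, x.1 0 ≠ p.head hp0 →
      ∀ i < p.length, some ((g • x).1 i) = p[i]? := by
  obtain ⟨g, hg, hg1⟩ := Γ.bot_or_exists_ne_one.resolve_left hΓ1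
  obtain ⟨w, hwg⟩ : ∃ w, w = g.toWord := ⟨_, rfl⟩
  have hw : w ≠ [] := fun h1 => hg1 (FreeGroup.toWord_eq_nil_iff.1 (hwg ▸ h1))
  have hwr : FreeGroup.IsReduced w := hwg ▸ FreeGroup.isReduced_toWord
  -- With this `e` the word `p e w e⁻¹ p⁻¹` is reduced. It ends with the inverse of the first letter
  -- of `p`, so it cancels against `x` only if `x` begins with that letter.
  obtain ⟨e, he1, he2, he3⟩ := exists_letter_ne hd ((p.getLast hp0).1, !(p.getLast hp0).2)
    ((w.head hw).1, !(w.head hw).2) (w.getLast hw)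
  have hc : FreeGroup.IsReduced (p ++ [e]) :=
    isReduced_append hp FreeGroup.IsReduced.singleton (by
      simpa [List.getLast?_eq_some_getLast hp0] using he1)
  have hcw : FreeGroup.IsReduced ((p ++ [e]) ++ w) :=
    isReduced_append hc hwr (by
      rintro s hs f hf rfl
      obtain rfl : e = s := by simpa using hs
      rw [List.head?_eq_some_head hw] at hf
      exact he2 (by rw [Option.some.inj hf]; simp))
  have hwc : FreeGroup.IsReduced (w ++ FreeGroup.invRev (p ++ [e])) :=
    isReduced_append hwr (isReduced_invRev hc) (by
      intro s hs f hf h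
      rw [List.getLast?_eq_some_getLast hw] at hs
      obtain rfl : (e.1, !e.2) = f := by simpa [FreeGroup.invRev] using hf
      apply he3
      rw [Option.some.inj hs]
      simpa [Prod.ext_iff] using h)
  have hred := hcw.append_overlap hwc hw
  refine ⟨FreeGroup.mk (p ++ [e]) * g * (FreeGroup.mk (p ++ [e]))⁻¹, hΓ.conj_mem g hg _,
    fun x hx i hi => ?_⟩
  have hredx := isReduced_append hred (FreeGroup.IsReduced.singleton (a := x.1 0)) (by
    intro s hs f hf h
    obtain rfl : x.1 0 = f := by simpa using hf
    apply hx
    obtain rfl : ((p.head hp0).1, !(p.head hp0).2) = s := by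
      have hlast : FreeGroup.invRev (p ++ [e]) =
          FreeGroup.invRev (p.tail ++ [e]) ++ [((p.head hp0).1, !(p.head hp0).2)] := by
        conv_lhs => rw [← List.cons_head_tail hp0]
        simp only [FreeGroup.invRev, List.cons_append, List.map_cons, List.reverse_cons]
      rw [hlast, ← List.append_assoc, List.getLast?_concat] at hs
      exact Option.some.inj hs
    simpa using h)
  have h1 := mk_smul_apply hredx (n := i) (by simp; omega)
  rw [← FreeGroup.mk_toWord (x := g), ← hwg, FreeGroup.inv_mk, FreeGroup.mul_mk,
    FreeGroup.mul_mk, h1]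
  simp only [List.append_assoc]
  rw [List.getElem?_append_left hi]

theorem isMinimal (hd : 2 ≤ d) {Γ : Subgroup (FreeGroup (Fin d))}
    (hΓ : Γ.Normal) (hΓ1 : Γ ≠ ⊥) : MulAction.IsMinimal Γ (FreeBoundary d) := by
  refine ⟨fun x => dense_iff_inter_open.2 fun U hU ⟨y, hy⟩ => ?_⟩
  obtain ⟨n, hn⟩ := exists_forall_lt_imp_mem hU hy
  obtain ⟨p, hp⟩ : ∃ p, p = (List.range (n + 1)).map y.1 := ⟨_, rfl⟩
  have hp0 : p ≠ [] := by simp [hp]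
  obtain ⟨g, hg, hgx⟩ := exists_mem_forall_smul_apply hd hΓ hΓ1
    (p := p) (hp ▸ isReduced_map_range y _) hp0
  have key : ∀ z : FreeBoundary d, z.1 0 ≠ p.head hp0 → g • z ∈ U := by
    refine fun z hz => hn _ fun i hi => ?_
    have := hgx z hz i (by simp [hp]; omega)
    apply Option.some.inj
    rw [this]
    simp [hp, show i < n + 1 by omega]
  -- In the exceptional case another element of `Γ` first changes the initial letter of `x`.
  by_cases hx : x.1 0 = p.head hp0
  · obtain ⟨e, he, -, -⟩ := exists_letter_ne hd (x.1 0) (x.1 0) (x.1 0)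
    obtain ⟨h, hh, hhx⟩ := exists_mem_forall_smul_apply hd hΓ hΓ1
      (p := [e]) FreeGroup.IsReduced.singleton (by simp)
    refine ⟨g • h • x, key _ ?_, ⟨⟨g, hg⟩ * ⟨h, hh⟩, mul_smul g h x⟩⟩
    have := hhx x (by simpa using he.symm) 0 (by simp)
    rw [← hx, Option.some.inj this]
    exact he
  · exact ⟨g • x, key x hx, ⟨⟨g, hg⟩, rfl⟩⟩

end FreeBoundary

/-! ### Quotients of compact spaces by closed equivalence relations -/

/-- The quotient map of a compact Hausdorff space by a closed equivalence relation is closed. -/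
theorem isClosedMap_quotient_mk_of_isClosed {X : Type*} [TopologicalSpace X] [CompactSpace X]
    (s : Setoid X) (hs : IsClosed {p : X × X | s p.1 p.2}) : IsClosedMap (Quotient.mk s) := by
  intro C hC
  rw [← isQuotientMap_quotient_mk'.isClosed_preimage]
  change IsClosed (Quotient.mk s ⁻¹' _)
  -- The saturation of `C` is a projection of a closed set along a compact factor.
  have : Quotient.mk s ⁻¹' (Quotient.mk s '' C) =
      Prod.snd '' ({p : X × X | s p.1 p.2} ∩ Prod.fst ⁻¹' C) := by
    ext y
    constructor
    · rintro ⟨x, hx, hxy⟩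
      exact ⟨(x, y), ⟨Quotient.exact hxy, hx⟩, rfl⟩
    · rintro ⟨⟨x, y⟩, ⟨hxy, hx⟩, rfl⟩
      exact ⟨x, hx, Quotient.sound hxy⟩
  rw [this]
  exact isClosedMap_snd_of_compactSpace _ (hs.inter (hC.preimage continuous_fst))

/-- The quotient of a compact Hausdorff space by a closed equivalence relation is Hausdorff. -/
theorem t2Space_quotient_of_isClosed {X : Type*} [TopologicalSpace X] [CompactSpace X]
    [T2Space X] (s : Setoid X) (hs : IsClosed {p : X × X | s p.1 p.2}) :
    T2Space (Quotient s) := by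
  have hmap := isClosedMap_quotient_mk_of_isClosed s hs
  have hfib : ∀ q : Quotient s, IsClosed (Quotient.mk s ⁻¹' {q}) := by
    intro q
    obtain ⟨x, rfl⟩ := Quotient.exists_rep q
    have h := hmap {x} isClosed_singleton
    rw [Set.image_singleton] at h
    exact h.preimage continuous_quotient_mk'
  refine ⟨fun p q hpq => ?_⟩
  obtain ⟨U, V, hU, hV, hpU, hqV, hUV⟩ := normal_separation (hfib p) (hfib q)
    (Disjoint.preimage _ (Set.disjoint_singleton.2 hpq))
  -- The points whose whole fibre lies in `U` form an open set because the quotient map is closed.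
  refine ⟨Set.kernImage (Quotient.mk s) U, Set.kernImage (Quotient.mk s) V,
    isClosedMap_iff_kernImage.1 hmap hU, isClosedMap_iff_kernImage.1 hmap hV,
    fun x hx => hpU hx, fun x hx => hqV hx, ?_⟩
  rw [Set.disjoint_left]
  intro r hrU hrV
  obtain ⟨x, rfl⟩ := Quotient.exists_rep r
  exact Set.disjoint_left.1 hUV (hrU rfl) (hrV rfl)

/-! ### The relation: equivalence, closedness and stabilizers -/

section pairRel

variable {d : ℕ} {T : Set (FreeGroup (Fin d))} {Γ : Subgroup (FreeGroup (Fin d))}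

/-- A pair of distinct related points is the pair of limit points of a conjugate of an element
of `T ∪ T⁻¹`. -/
theorem exists_isPowLimit_of_mem_pairRel {x y : FreeBoundary d} (h : (x, y) ∈ pairRel T Γ)
    (hxy : x ≠ y) : ∃ g, ∃ t, (t ∈ T ∨ t⁻¹ ∈ T) ∧ IsPowLimit (g * t * g⁻¹) x ∧
      IsPowLimit (g * t * g⁻¹)⁻¹ y := by
  obtain h | ⟨g, -, t, ht, u, v, hu, hv, h⟩ := h
  · exact absurd h hxy
  · obtain ⟨rfl, rfl⟩ := Prod.mk.inj h
    refine ⟨g, t, ht, hu.conj g, ?_⟩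
    rw [show (g * t * g⁻¹)⁻¹ = g * t⁻¹ * g⁻¹ by group]
    exact hv.conj g

theorem mem_pairRel_symm {x y : FreeBoundary d} (h : (x, y) ∈ pairRel T Γ) :
    (y, x) ∈ pairRel T Γ := by
  obtain h | ⟨g, hg, t, ht, u, v, hu, hv, h⟩ := h
  · exact Or.inl h.symm
  · obtain ⟨rfl, rfl⟩ := Prod.mk.inj h
    exact Or.inr ⟨g, hg, t⁻¹, by rwa [inv_inv, or_comm], v, u, hv, by rwa [inv_inv], rfl⟩

theorem indivisible_of_mem_or_inv_mem (hT : ∀ t ∈ T, Indivisible t) {t : FreeGroup (Fin d)}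
    (ht : t ∈ T ∨ t⁻¹ ∈ T) : Indivisible t := by
  obtain ht | ht := ht
  · exact hT t ht
  · simpa using (hT _ ht).inv

/-- Each point is related to at most one other point. -/
theorem eq_of_mem_pairRel_of_mem_pairRel (hT : ∀ t ∈ T, Indivisible t) {x y z : FreeBoundary d}
    (hxy : (x, y) ∈ pairRel T Γ) (hyz : (y, z) ∈ pairRel T Γ) (h1 : x ≠ y) (h2 : y ≠ z) :
    x = z := by
  obtain ⟨g, t, ht, hx, hy⟩ := exists_isPowLimit_of_mem_pairRel hxy h1
  obtain ⟨h, s, hs, hy', hz⟩ := exists_isPowLimit_of_mem_pairRel hyz h2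
  have hta := (indivisible_of_mem_or_inv_mem hT ht).conj g
  have hsa := (indivisible_of_mem_or_inv_mem hT hs).conj h
  -- Both conjugates fix `y`. If they were equal, `y` would be the attracting point `x`; so they are
  -- mutually inverse, and `z` is that point.
  obtain h3 | h3 := FreeBoundary.eq_or_eq_inv_of_smul_eq
    (inv_smul_eq_iff.1 hy.smul_eq).symm hy'.smul_eq hta hsa
  · rw [h3] at hy'
    exact absurd (hx.unique hy') h1
  · rw [h3, inv_inv] at hz
    exact hx.unique hz

theorem equivalence_pairRel (hT : ∀ t ∈ T, Indivisible t) :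
    Equivalence fun x y => (x, y) ∈ pairRel T Γ where
  refl _ := Or.inl rfl
  symm := mem_pairRel_symm
  trans {x y z} hxy hyz := by
    by_cases h1 : x = y
    · rwa [h1]
    by_cases h2 : y = z
    · rwa [← h2]
    exact Or.inl (eq_of_mem_pairRel_of_mem_pairRel hT hxy hyz h1 h2)

theorem isInvariantRel_pairRel : IsInvariantRel Γ (pairRel T Γ) := by
  intro γ x y h
  obtain h | ⟨g, hg, t, ht, u, v, hu, hv, h⟩ := h
  · exact Or.inl (congrArg (γ • ·) h)
  · obtain ⟨rfl, rfl⟩ := Prod.mk.inj h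
    refine Or.inr ⟨γ * g, Γ.mul_mem γ.2 hg, t, ht, u, v, hu, hv, ?_⟩
    rw [mul_smul, mul_smul]
    rfl

theorem finite_setOf_norm_le (n : ℕ) : {g : FreeGroup (Fin d) | g.norm ≤ n}.Finite :=
  (List.finite_length_le (Fin d × Bool) n).preimage FreeGroup.toWord_injective.injOn

theorem exists_isConj_norm_le (hT : (ConjClasses.mk '' T).Finite) :
    ∃ M, ∀ t, t ∈ T ∨ t⁻¹ ∈ T → ∃ k s, t = k * s * k⁻¹ ∧ s.norm ≤ M := by
  obtain ⟨M, hM⟩ := (hT.image fun c => c.out.norm).bddAbove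
  have key : ∀ t ∈ T, ∃ k s, t = k * s * k⁻¹ ∧ s.norm ≤ M := by
    intro t ht
    have h1 : IsConj (Quotient.out (ConjClasses.mk t)) t :=
      ConjClasses.mk_eq_mk_iff_isConj.1 (Quotient.out_eq (ConjClasses.mk t))
    obtain ⟨k, hk⟩ := isConj_iff.1 h1
    exact ⟨k, _, hk.symm, hM ⟨_, ⟨t, ht, rfl⟩, rfl⟩⟩
  refine ⟨M, fun t ht => ?_⟩
  obtain ht | ht := ht
  · exact key t ht
  · obtain ⟨k, s, h1, h2⟩ := key _ ht
    refine ⟨k, s⁻¹, ?_, by rwa [FreeGroup.norm_inv_eq]⟩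
    rw [← inv_inj, h1]
    group

/-- Such a pair is determined by a conjugate of norm at most `2 * i + M`, where `M` bounds the norms
of representatives of the conjugacy classes. -/
theorem finite_setOf_mem_pairRel_apply_ne (hT : (ConjClasses.mk '' T).Finite) (i : ℕ) :
    {p ∈ pairRel T Γ | p.1.1 i ≠ p.2.1 i}.Finite := by
  obtain ⟨M, hM⟩ := exists_isConj_norm_le hT
  refine ((finite_setOf_norm_le (d := d) (2 * i + M)).biUnion (t := fun a =>
    {p : FreeBoundary d × FreeBoundary d | IsPowLimit a p.1 ∧ IsPowLimit a⁻¹ p.2})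
    fun a _ => Set.Subsingleton.finite ?_).subset ?_
  · rintro ⟨u, v⟩ ⟨hu, hv⟩ ⟨u', v'⟩ ⟨hu', hv'⟩
    exact Prod.ext (hu.unique hu') (hv.unique hv')
  · rintro ⟨x, y⟩ ⟨hxy, hi⟩
    obtain ⟨g, t, ht, hx, hy⟩ := exists_isPowLimit_of_mem_pairRel hxy fun h => hi (by rw [h])
    obtain ⟨k, s, rfl, hs⟩ := hM t ht
    refine Set.mem_biUnion (x := g * (k * s * k⁻¹) * g⁻¹) ?_ ⟨hx, hy⟩
    have h1 : g * (k * s * k⁻¹) * g⁻¹ = (g * k) * s * (g * k)⁻¹ := by group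
    rw [h1] at hx hy ⊢
    have := IsPowLimit.norm_conj_le hx hy hi
    change FreeGroup.norm _ ≤ _
    omega

theorem isClosed_pairRel (hT : (ConjClasses.mk '' T).Finite) : IsClosed (pairRel T Γ) := by
  rw [← isOpen_compl_iff, isOpen_iff_forall_mem_open]
  rintro ⟨x, y⟩ hxy
  have hne : x ≠ y := fun h => hxy (Or.inl h)
  obtain ⟨i, hi⟩ : ∃ i, x.1 i ≠ y.1 i := by
    by_contra! h
    exact hne (FreeBoundary.ext h)
  -- A product of cylinders separating `x` from `y`, minus the finitely many related pairs that
  -- differ at letter `i`.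
  refine ⟨{p | p.1.1 i ∈ ({x.1 i} : Set _) ∧ p.2.1 i ∈ ({y.1 i} : Set _)} \
    {p ∈ pairRel T Γ | p.1.1 i ≠ p.2.1 i}, ?_, ?_, ?_⟩
  · rintro p ⟨⟨h1, h2⟩, h3⟩ h4
    refine h3 ⟨h4, ?_⟩
    rw [h1, h2]
    exact hi
  · refine IsOpen.sdiff ?_ (finite_setOf_mem_pairRel_apply_ne hT i).isClosed
    exact ((FreeBoundary.isOpen_setOf_apply i {x.1 i}).preimage continuous_fst).inter
      ((FreeBoundary.isOpen_setOf_apply i {y.1 i}).preimage continuous_snd)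
  · exact ⟨⟨rfl, rfl⟩, fun h => hxy h.1⟩

/-- A point which is fixed up to the relation by a non-neutral element of `Γ` is related only to
itself. -/
theorem eq_of_mem_pairRel_of_smul_mem_pairRel (hΓ : Γ.Normal) (hT : ∀ t ∈ T, Indivisible t)
    (hTΓ : ∀ n : ℤ, n ≠ 0 → ∀ t ∈ T, t ^ n ∉ Γ) {γ : Γ} (hγ : γ ≠ 1) {x y : FreeBoundary d}
    (hx : (γ • x, x) ∈ pairRel T Γ) (hxy : (x, y) ∈ pairRel T Γ) : x = y := by
  by_contra hne
  obtain ⟨a, ha⟩ : ∃ a : FreeGroup (Fin d), a = γ := ⟨_, rfl⟩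
  have ha1 : a ≠ 1 := fun h => hγ (Subtype.ext (ha ▸ h))
  have haΓ : a ∈ Γ := ha ▸ γ.2
  have hγa : ∀ z : FreeBoundary d, γ • z = a • z := fun z => by rw [ha]; rfl
  have hγxy := isInvariantRel_pairRel γ x y hxy
  have hE := equivalence_pairRel (Γ := Γ) hT
  simp only [hγa] at hx hγxy
  have hy : (a • y, y) ∈ pairRel T Γ := hE.trans (hE.trans (hE.symm hγxy) hx) hxy
  -- The class of `x` is `{x, y}` and `a` permutes it. Also `a ^ 2 ≠ 1` since free groups are
  -- torsion-free.
  have hsq : a ^ 2 • x = x := by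
    rw [pow_two, mul_smul]
    by_cases h1 : a • x = x
    · rw [h1, h1]
    have h2 : a • x = y := eq_of_mem_pairRel_of_mem_pairRel hT hx hxy h1 hne
    have h3 : a • y ≠ y := fun h3 => hne (MulAction.injective a (h2.trans h3.symm))
    rw [h2]
    exact eq_of_mem_pairRel_of_mem_pairRel hT hy (hE.symm hxy) h3 (Ne.symm hne)
  obtain ⟨g, t, ht, hx', -⟩ := exists_isPowLimit_of_mem_pairRel hxy hne
  obtain ⟨m, n, -, hn, hmn⟩ := FreeBoundary.exists_zpow_eq_zpow_of_smul_eq hsq hx'.smul_eq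
    (fun h => ha1 (by simpa using h)) ((indivisible_of_mem_or_inv_mem hT ht).conj g).ne_one
  -- A power of the conjugate `g * t * g⁻¹` equals a power of `a ∈ Γ`; normality removes the
  -- conjugation.
  have htn : t ^ n ∈ Γ := by
    have h1 : t ^ n = g⁻¹ * (a ^ 2) ^ m * g⁻¹⁻¹ := by
      rw [hmn, conj_zpow]
      group
    rw [h1]
    exact hΓ.conj_mem _ (Γ.zpow_mem (Γ.pow_mem haΓ 2) m) _
  obtain ht | ht := ht
  · exact hTΓ n hn t ht htn
  · exact hTΓ n hn _ ht (by rw [inv_zpow]; exact Γ.inv_mem htn)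

end pairRel

/-! ### The main theorem -/

theorem mainTheorem4 (d : ℕ) (hd : 2 ≤ d) (Γ : Subgroup (FreeGroup (Fin d)))
    (hΓ : Γ.Normal) (hΓ1 : Γ ≠ ⊥) :
    IsTopologicallyFree Γ (FreeBoundary d) ∧
    MulAction.IsMinimal Γ (FreeBoundary d) ∧
    ∀ T : Set (FreeGroup (Fin d)),
      (∀ t ∈ T, Indivisible t) →
      (ConjClasses.mk '' T).Finite →
      (∀ n : ℤ, n ≠ 0 → ∀ t ∈ T, t ^ n ∉ Γ) →
      ∃ (hE : Equivalence fun x y => (x, y) ∈ pairRel T Γ)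
        (hR : IsInvariantRel Γ (pairRel T Γ)),
        letI s : Setoid (FreeBoundary d) := ⟨fun x y => (x, y) ∈ pairRel T Γ, hE⟩
        letI : MulAction Γ (Quotient s) := quotientAction (pairRel T Γ) hE hR
        letI π : FreeBoundary d → Quotient s := Quotient.mk s
        T2Space (Quotient s) ∧
        ContinuousConstSMul Γ (Quotient s) ∧
        (∀ (g : Γ) (x : FreeBoundary d), π (g • x) = g • π x) ∧
        IsQuotientMap π ∧
        (∀ K : Set (Quotient s), IsCompact K → IsCompact (π ⁻¹' K)) ∧
        ∀ q : Quotient s, MulAction.stabilizer Γ q ≠ ⊥ → (π ⁻¹' {q}).ncard = 1 := by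
  refine ⟨FreeBoundary.isTopologicallyFree hd Γ, FreeBoundary.isMinimal hd hΓ hΓ1,
    fun T hT hTfin hTΓ => ⟨equivalence_pairRel hT, isInvariantRel_pairRel, ?_⟩⟩
  let s : Setoid (FreeBoundary d) := ⟨fun x y => (x, y) ∈ pairRel T Γ, equivalence_pairRel hT⟩
  let π : FreeBoundary d → Quotient s := Quotient.mk s
  let _ : MulAction Γ (Quotient s) :=
    quotientAction (pairRel T Γ) (equivalence_pairRel hT) isInvariantRel_pairRel
  have hT2 : T2Space (Quotient s) := t2Space_quotient_of_isClosed s (isClosed_pairRel hTfin)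
  have hπ : Continuous π := continuous_quotient_mk'
  refine ⟨hT2, ⟨fun γ => ?_⟩, fun _ _ => rfl, isQuotientMap_quotient_mk',
    fun K hK => (hK.isClosed.preimage hπ).isCompact, fun q hq => ?_⟩
  · exact continuous_quot_lift _ (hπ.comp (continuous_const_smul (γ : FreeGroup (Fin d))))
  · obtain ⟨γ, hγ, hγ1⟩ := (MulAction.stabilizer Γ q).bot_or_exists_ne_one.resolve_left hq
    obtain ⟨x, rfl⟩ := Quotient.exists_rep q
    refine Set.ncard_eq_one.2 ⟨x, Set.eq_singleton_iff_unique_mem.2 ⟨rfl, fun y hy => ?_⟩⟩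
    exact (eq_of_mem_pairRel_of_smul_mem_pairRel hΓ hT hTΓ hγ1
      (Quotient.exact (MulAction.mem_stabilizer_iff.1 hγ))
      (mem_pairRel_symm (Quotient.exact hy))).symm
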